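/- Let $G$ be a finite simple graph (no loops or multiple edges), and let $\tau(G)$ be the number of spanning trees of $G$. Let $\mathcal{L}(G)$ be the line graph of $G$: its vertices are the edges of $G$, two distinct ones being adjacent when they share an endpoint; let $A(\mathcal{L}(G))$ be its adjacency matrix. If $G$ has an odd number of vertices and $\tau(G)$ is not divisible by $4$, then $A(\mathcal{L}(G))$ is nonsingular over $\mathbb{R}$. (If $G$ has no edges, $A(\mathcal{L}(G))$ is the $0\times 0$ matrix, which is nonsingular by convention.) -/

import Mathlib

/-- The number `τ(G)` of spanning trees of a graph `G` on the vertex type `V`. A spanning subgraph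
of `G` is a simple graph on the same vertices whose edges are edges of `G`, so the spanning trees
of `G` are the trees `T` on `V` with `T ≤ G`. For finite `V` there are finitely many of them. -/
noncomputable def SimpleGraph.numSpanningTrees {V : Type*} (G : SimpleGraph V) : ℕ :=
  {T : SimpleGraph V | T ≤ G ∧ T.IsTree}.ncard

/-! Let `N` be the unsigned incidence matrix. Then `Nᵀ * N = 2 + A(L(G))` and `N * Nᵀ = D + A`, so a
singular line graph gives an integer `x ≠ 0` with `(D + A) x = 2 x`, primitive after division by its
gcd. Hence the Laplacian satisfies `(D - A) x = 2 w` with `w = x - A x`. Parity of `xᵀ A x` forces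
`∑ x` to be even; the order being odd, some `x r` is even. Reducing at `r`, the vector `z = x - x r`
has an odd entry, is sent to `2 w`, and `w ⬝ᵥ z` is even. For a symmetric matrix this makes the
determinant divisible by 4 (`Matrix.IsSymm.four_dvd_det`), and by the matrix-tree theorem that
determinant is `τ(G)`. -/

open Matrix

/-! ### Spanning trees as rooted parent functions -/

/-- A function sending every vertex other than `r` to a vertex is rooted if iterating it
always leads to `r`, as witnessed by a height function that it decreases. -/
def IsRooted {V : Type*} {r : V} (f : {v : V // v ≠ r} → V) : Prop :=
  ∃ d : V → ℕ, ∀ v, d (f v) < d v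

/-- The graph joining every vertex other than `r` to its image under `f`. -/
def parentGraph {V : Type*} {r : V} (f : {v : V // v ≠ r} → V) : SimpleGraph V :=
  SimpleGraph.fromEdgeSet (Set.range fun v : {v : V // v ≠ r} => s((v : V), f v))

theorem IsRooted.ne {V : Type*} {r : V} {f : {v : V // v ≠ r} → V} (hf : IsRooted f)
    (v : {v : V // v ≠ r}) : (v : V) ≠ f v := by
  obtain ⟨d, hd⟩ := hf
  intro h
  have := hd v
  rw [← h] at this
  exact lt_irrefl _ this

theorem IsRooted.parentGraph_adj {V : Type*} {r : V} {f : {v : V // v ≠ r} → V}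
    (hf : IsRooted f) (v : {v : V // v ≠ r}) : (parentGraph f).Adj v (f v) := by
  rw [parentGraph, SimpleGraph.fromEdgeSet_adj]
  exact ⟨⟨v, rfl⟩, hf.ne v⟩

theorem IsRooted.connected_parentGraph {V : Type*} {r : V} {f : {v : V // v ≠ r} → V}
    (hf : IsRooted f) : (parentGraph f).Connected := by
  have key : ∀ v, (parentGraph f).Reachable v r := by
    obtain ⟨d, hd⟩ := id hf
    intro v
    induction hn : d v using Nat.strong_induction_on generalizing v with
    | _ n ih =>
      by_cases hv : v = r
      · rw [hv]
      · exact (hf.parentGraph_adj ⟨v, hv⟩).reachable.trans (ih _ (hn ▸ hd ⟨v, hv⟩) _ rfl)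
  have : Nonempty V := ⟨r⟩
  exact ⟨fun u v => (key u).trans (key v).symm⟩

theorem IsRooted.isTree_parentGraph {V : Type*} [Finite V] {r : V} {f : {v : V // v ≠ r} → V}
    (hf : IsRooted f) : (parentGraph f).IsTree := by
  classical
  have := Fintype.ofFinite V
  rw [SimpleGraph.isTree_iff_connected_and_card]
  refine ⟨hf.connected_parentGraph, le_antisymm ?_
    hf.connected_parentGraph.card_vert_le_card_edgeSet_add_one⟩
  have h1 : Nat.card (parentGraph f).edgeSet ≤ Nat.card {v : V // v ≠ r} := by
    refine Nat.card_le_card_of_surjective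
      (fun v : {v : V // v ≠ r} => ⟨s((v : V), f v), hf.parentGraph_adj v⟩) ?_
    rintro ⟨e, he⟩
    rw [parentGraph, SimpleGraph.edgeSet_fromEdgeSet] at he
    obtain ⟨v, rfl⟩ := he.1
    exact ⟨v, rfl⟩
  have h2 : Nat.card {v : V // v ≠ r} + 1 = Nat.card V := by
    rw [Nat.card_eq_fintype_card, Nat.card_eq_fintype_card, Fintype.card_subtype_compl,
      Fintype.card_subtype_eq]
    have := Fintype.card_pos_iff.2 ⟨r⟩
    omega
  omega

theorem SimpleGraph.Connected.exists_adj_dist_lt {V : Type*} {G : SimpleGraph V}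
    (hG : G.Connected) {r v : V} (hv : v ≠ r) : ∃ w, G.Adj v w ∧ G.dist w r < G.dist v r := by
  obtain ⟨p, hp⟩ := hG.exists_walk_length_eq_dist v r
  cases p with
  | nil => exact absurd rfl hv
  | cons h q =>
    refine ⟨_, h, ?_⟩
    rw [← hp, SimpleGraph.Walk.length_cons]
    exact Nat.lt_succ_of_le (SimpleGraph.dist_le q)

/-- A function `f` is determined by its parent graph: it is the only function that moves every
vertex to a neighbour closer to the root. -/
theorem eq_of_parentGraph_dist_lt {V : Type*} {r : V} {f : {v : V // v ≠ r} → V}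
    {p : {v : V // v ≠ r} → V}
    (hp : ∀ v : {v : V // v ≠ r}, (parentGraph f).Adj v (p v) ∧
      (parentGraph f).dist (p v) r < (parentGraph f).dist v r) : f = p := by
  funext v
  induction hn : (parentGraph f).dist (v : V) r using Nat.strong_induction_on generalizing v with
  | _ n ih =>
    obtain ⟨h1, h2⟩ := hp v
    have h3 := h1
    rw [parentGraph, SimpleGraph.fromEdgeSet_adj] at h3
    obtain ⟨⟨w, hw⟩, -⟩ := h3
    rcases Sym2.eq_iff.1 hw with ⟨h, h'⟩ | ⟨h, h'⟩
    · rw [Subtype.ext h] at h'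
      exact h'
    -- Here `w = p v` and `f w = v`; induction gives `p w = v`, so each of `v` and `w` would be
    -- closer to `r` than the other.
    · have h4 := ih _ (hn ▸ (h ▸ h2 : (parentGraph f).dist (w : V) r < _)) w rfl
      have h5 := (hp w).2
      rw [← h4, h', h] at h5
      exact absurd h2 h5.le.not_gt

theorem injOn_parentGraph {V : Type*} {r : V} :
    Set.InjOn (parentGraph (V := V) (r := r)) {f | IsRooted f} := by
  intro f hf g hg hfg
  choose p hp using fun v : {v : V // v ≠ r} =>
    hf.connected_parentGraph.exists_adj_dist_lt v.2
  have h2 : g = p := eq_of_parentGraph_dist_lt (by rw [← hfg]; exact hp)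
  rw [eq_of_parentGraph_dist_lt hp, h2]

theorem parentGraph_le_iff {V : Type*} {r : V} {f : {v : V // v ≠ r} → V} (hf : IsRooted f)
    {G : SimpleGraph V} : parentGraph f ≤ G ↔ ∀ v : {v : V // v ≠ r}, G.Adj v (f v) := by
  refine ⟨fun h v => h (hf.parentGraph_adj v), fun h a b hab => ?_⟩
  rw [parentGraph, SimpleGraph.fromEdgeSet_adj] at hab
  obtain ⟨⟨v, hv⟩, -⟩ := hab
  have := h v
  rwa [← SimpleGraph.mem_edgeSet, show s((v : V), f v) = s(a, b) from hv] at this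

/-- In a tree `T`, pick for each vertex a neighbour closer to `r`. The resulting parent graph is
connected and lies in `T`, so it equals `T` because trees are minimal connected graphs. -/
theorem SimpleGraph.numSpanningTrees_eq_ncard_isRooted {V : Type*} [Finite V]
    (G : SimpleGraph V) (r : V) :
    G.numSpanningTrees =
      {f : {v : V // v ≠ r} → V | (∀ v : {v : V // v ≠ r}, G.Adj v (f v)) ∧ IsRooted f}.ncard := by
  rw [numSpanningTrees, ← (injOn_parentGraph.mono fun f hf => hf.2).ncard_image]
  congr 1
  ext T
  constructor
  · rintro ⟨hTG, hT⟩
    choose p hp using fun v : {v : V // v ≠ r} => hT.connected.exists_adj_dist_lt v.2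
    have hr : IsRooted p := ⟨fun v => T.dist v r, fun v => (hp v).2⟩
    have hle : parentGraph p ≤ T := (parentGraph_le_iff hr).2 fun v => (hp v).1
    exact ⟨p, ⟨fun v => hTG (hp v).1, hr⟩, le_antisymm hle
      ((isTree_iff_minimal_connected.1 hT).2 hr.connected_parentGraph hle)⟩
  · rintro ⟨f, ⟨hfG, hf⟩, rfl⟩
    exact ⟨(parentGraph_le_iff hf).2 hfG, hf.isTree_parentGraph⟩

/-! ### The matrix-tree theorem -/

/-- The identity minus the matrix of `f`, with the column of `r` removed. -/
def parentMatrix {V : Type*} [DecidableEq V] {r : V} (f : {v : V // v ≠ r} → V) :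
    Matrix {v : V // v ≠ r} {v : V // v ≠ r} ℤ :=
  of fun v w => (if v = w then 1 else 0) - if f v = w then 1 else 0

/-- Grouping vertices by height makes the transpose block triangular with identity diagonal blocks.
-/
theorem IsRooted.det_parentMatrix {V : Type*} [Fintype V] [DecidableEq V] {r : V}
    {f : {v : V // v ≠ r} → V} (hf : IsRooted f) : (parentMatrix f).det = 1 := by
  obtain ⟨d, hd⟩ := hf
  have hoff : ∀ v w : {v : V // v ≠ r}, v ≠ w → d v ≤ d w → parentMatrix f v w = 0 := by
    intro v w hvw hle
    have hfw : f v ≠ w := by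
      intro h
      have := hd v
      rw [h] at this
      omega
    simp [parentMatrix, hvw, hfw]
  have hdiag : ∀ v : {v : V // v ≠ r}, parentMatrix f v v = 1 := by
    intro v
    have hfw : f v ≠ v := by
      intro h
      have := hd v
      rw [h] at this
      omega
    simp [parentMatrix, hfw]
  have hT : (parentMatrix f)ᵀ.BlockTriangular fun v : {v : V // v ≠ r} => d v := by
    intro v w hvw
    exact hoff w v (by rintro rfl; exact lt_irrefl _ hvw) hvw.le
  rw [← det_transpose, hT.det]
  refine Finset.prod_eq_one fun k _ => ?_
  have : (parentMatrix f)ᵀ.toSquareBlock (fun v : {v : V // v ≠ r} => d v) k = 1 := by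
    ext v w
    by_cases h : v = w
    · subst h
      simp [toSquareBlock_def, hdiag]
    · rw [one_apply_ne h, toSquareBlock_def]
      exact hoff _ _ (fun h' => h (Subtype.ext h'.symm)) (by rw [v.2, w.2])
  rw [this, det_one]

/-- The indicator of the vertices whose orbit never reaches `r` is a nonzero kernel vector. -/
theorem det_parentMatrix_of_not_isRooted {V : Type*} [Fintype V] [DecidableEq V] {r : V}
    {f : {v : V // v ≠ r} → V} (hf : ¬ IsRooted f) : (parentMatrix f).det = 0 := by
  classical
  let F : V → V := fun v => if h : v = r then r else f ⟨v, h⟩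
  have hF : ∀ v : {v : V // v ≠ r}, F v = f v := fun v => dif_neg v.2
  let R : V → Prop := fun v => ∃ k, F^[k] v = r
  have hR : ∀ v : {v : V // v ≠ r}, R v ↔ R (f v) := by
    intro v
    rw [← hF v]
    constructor
    · rintro ⟨k, hk⟩
      cases k with
      | zero => exact absurd hk v.2
      | succ k => exact ⟨k, hk⟩
    · rintro ⟨k, hk⟩
      exact ⟨k + 1, hk⟩
  have hex : ∃ v, ¬ R v := by
    by_contra! hall
    -- The first hitting time of `r` serves as height.
    refine hf ⟨fun v => Nat.find (hall v), fun v => ?_⟩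
    have h0 := Nat.find_spec (hall v)
    obtain ⟨k, hk⟩ : ∃ k, Nat.find (hall v) = k + 1 := by
      refine Nat.exists_eq_succ_of_ne_zero fun h => ?_
      rw [h] at h0
      exact v.2 h0
    change Nat.find _ < Nat.find _
    rw [hk, Nat.lt_succ_iff]
    refine Nat.find_min' _ ?_
    rw [hk, Function.iterate_succ_apply, hF] at h0
    exact h0
  have hRr : R r := ⟨0, rfl⟩
  obtain ⟨v₀, hv₀⟩ := hex
  rw [← exists_mulVec_eq_zero_iff]
  refine ⟨fun v => if R v then 0 else 1, fun h => ?_, ?_⟩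
  · have := congrFun h ⟨v₀, fun h : v₀ = r => hv₀ (h.symm ▸ hRr)⟩
    simp [hv₀] at this
  · funext v
    have h1 : ∀ u : V, ∑ w : {v : V // v ≠ r},
        (if u = w then (1 : ℤ) else 0) * (if R w then 0 else 1) = if R u then 0 else 1 := by
      intro u
      by_cases hu : u = r
      · rw [if_pos (show R u from hu.symm ▸ hRr)]
        refine Finset.sum_eq_zero fun w _ => ?_
        rw [if_neg (fun h : u = w => w.2 (h.symm.trans hu)), zero_mul]
      · rw [Finset.sum_eq_single ⟨u, hu⟩]
        · simp
        · intro w _ hw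
          rw [if_neg (fun h : u = w => hw (Subtype.ext h.symm)), zero_mul]
        · simp
    have h2 := h1 v
    have h3 := h1 (f v)
    simp only [← Subtype.ext_iff] at h2
    simp only [mulVec, dotProduct, parentMatrix, of_apply, sub_mul, Finset.sum_sub_distrib,
      Pi.zero_apply, h2, h3, hR v, sub_self]

/-- The Laplacian of `G` with the row and column of `r` removed. -/
def SimpleGraph.reducedLapMatrix {V : Type*} [Fintype V] [DecidableEq V] (G : SimpleGraph V)
    [DecidableRel G.Adj] (r : V) : Matrix {v : V // v ≠ r} {v : V // v ≠ r} ℤ :=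
  (G.lapMatrix ℤ).submatrix Subtype.val Subtype.val

/-- The matrix-tree theorem. -/
theorem SimpleGraph.det_reducedLapMatrix {V : Type*} [Fintype V] [DecidableEq V]
    (G : SimpleGraph V) [DecidableRel G.Adj] (r : V) :
    (G.reducedLapMatrix r).det = G.numSpanningTrees := by
  classical
  -- Row `v` is a sum over the neighbours `u` of `v`, so multilinearity expands the determinant over
  -- all choices of one neighbour per non-root vertex.
  let g : {v : V // v ≠ r} → V → {v : V // v ≠ r} → ℤ := fun v u =>
    if G.Adj v u then fun w => (if v = w then 1 else 0) - if u = w then 1 else 0 else 0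
  have hrow : G.reducedLapMatrix r = fun v => ∑ u, g v u := by
    funext v w
    simp only [reducedLapMatrix, submatrix_apply, lapMatrix, degMatrix, Matrix.sub_apply,
      diagonal_apply, adjMatrix_apply, Finset.sum_apply, g]
    have : ∀ u, (if G.Adj v u then fun w : {v : V // v ≠ r} =>
        (if v = w then (1 : ℤ) else 0) - if u = w then 1 else 0 else 0) w =
        (if G.Adj v u then (if v = w then (1 : ℤ) else 0) else 0) -
          if (w : V) = u then (if G.Adj v w then 1 else 0) else 0 := by
      intro u
      by_cases h : (w : V) = u
      · subst h
        split_ifs <;> simp_all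
      · have h' : u ≠ w := fun h' => h h'.symm
        by_cases h2 : G.Adj v u <;> simp [h, h', h2]
    simp only [this, Finset.sum_sub_distrib, Finset.sum_ite_eq, Finset.mem_univ, if_true]
    congr 1
    rw [← Finset.sum_filter, Finset.sum_const, ← G.neighborFinset_eq_filter, card_neighborFinset_eq_degree]
    simp [Subtype.ext_iff]
  have hdet : ∀ f : {v : V // v ≠ r} → V, det (fun v => g v (f v)) =
      if (∀ v : {v : V // v ≠ r}, G.Adj v (f v)) ∧ IsRooted f then 1 else 0 := by
    intro f
    by_cases h : ∀ v : {v : V // v ≠ r}, G.Adj v (f v)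
    · have : (fun v => g v (f v)) = parentMatrix f := by
        funext v w
        simp [g, h v, parentMatrix]
      rw [this]
      by_cases hf : IsRooted f
      · rw [if_pos ⟨h, hf⟩, hf.det_parentMatrix]
      · rw [if_neg fun h' => hf h'.2, det_parentMatrix_of_not_isRooted hf]
    · rw [if_neg fun h' => h h'.1]
      push Not at h
      obtain ⟨v, hv⟩ := h
      refine det_eq_zero_of_row_eq_zero v fun w => ?_
      simp [g, hv]
  rw [hrow]
  have := (detRowAlternating (R := ℤ) (n := {v : V // v ≠ r})).toMultilinearMap.map_sum g
  refine this.trans ((Finset.sum_congr rfl fun f _ => hdet f).trans ?_)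
  rw [Finset.sum_boole, G.numSpanningTrees_eq_ncard_isRooted r, Set.ncard_eq_toFinset_card']
  simp [Set.toFinset_ofPred]

/-! ### Divisibility of determinants by 2 and 4 -/

/-- If an odd integer vector is mapped to an even one, the determinant is even. -/
theorem Matrix.two_dvd_det_of_mulVec {n : Type*} [Fintype n] [DecidableEq n] {M : Matrix n n ℤ}
    {x w : n → ℤ} (h : M *ᵥ x = (2 : ℤ) • w) {i : n} (hi : Odd (x i)) : 2 ∣ M.det := by
  have h1 : M.det * x i = 2 * (M.adjugate *ᵥ w) i := by
    have := congrFun (congrArg (M.adjugate *ᵥ ·) h) i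
    simpa only [mulVec_mulVec, adjugate_mul, mulVec_smul, smul_mulVec, one_mulVec, Pi.smul_apply,
      smul_eq_mul] using this
  exact (Int.isCoprime_iff_gcd_eq_one.2 (by
    simpa using (Int.isCoprime_iff_gcd_eq_one.1 (Int.isCoprime_two_left.2 hi)))).dvd_of_dvd_mul_right
    ⟨_, h1⟩

/-- Cramer's rule gives one factor 2, leaving `M` with column `i` replaced by `w`. By symmetry its
transpose is `M` with row `i` replaced by `w`; it also sends `x` to an even vector, whose entry at
`i` is `w ⬝ᵥ x`. -/
theorem Matrix.IsSymm.four_dvd_det {n : Type*} [Fintype n] [DecidableEq n] {M : Matrix n n ℤ}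
    (hM : M.IsSymm) {x w : n → ℤ} (h : M *ᵥ x = (2 : ℤ) • w) (hw : 2 ∣ w ⬝ᵥ x) {i : n}
    (hi : Odd (x i)) : 4 ∣ M.det := by
  have h1 : M.det * x i = 2 * (M.updateCol i w).det := by
    have := congrFun (congrArg (M.adjugate *ᵥ ·) h) i
    rw [← cramer_apply, cramer_eq_adjugate_mulVec]
    simpa only [mulVec_mulVec, adjugate_mul, mulVec_smul, smul_mulVec, one_mulVec, Pi.smul_apply,
      smul_eq_mul] using this
  obtain ⟨t, ht⟩ := hw
  have h2 : (M.updateCol i w)ᵀ *ᵥ x = (2 : ℤ) • Function.update w i t := by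
    rw [← updateRow_transpose, hM.eq]
    funext j
    by_cases hj : j = i
    · subst hj
      simp [mulVec, ht]
    · have := congrFun h j
      simp only [mulVec, Pi.smul_apply] at this ⊢
      rw [updateRow_ne hj, this, Function.update_of_ne hj]
  have h3 := two_dvd_det_of_mulVec h2 hi
  rw [det_transpose] at h3
  have h4 : (4 : ℤ) ∣ M.det * x i := by
    rw [h1]
    exact mul_dvd_mul_left 2 h3
  have h5 : IsCoprime (4 : ℤ) (x i) := by
    have := (Int.isCoprime_two_left.2 hi).pow_left (m := 2)
    norm_num at this
    exact this
  exact h5.dvd_of_dvd_mul_right h4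

/-! ### From the line graph to the signless Laplacian -/

/-- If the line graph is singular, then `2` is an eigenvalue of the signless Laplacian. -/
theorem SimpleGraph.exists_degree_mul_add_eq_two_mul {V : Type*} [Fintype V] [DecidableEq V]
    (G : SimpleGraph V) [DecidableRel G.Adj] [Fintype G.edgeSet] [DecidableRel G.lineGraph.Adj]
    (h : (G.lineGraph.adjMatrix ℤ).det = 0) :
    ∃ x : V → ℤ, x ≠ 0 ∧ ∀ v, G.degree v * x v + (G.adjMatrix ℤ *ᵥ x) v = 2 * x v := by
  classical
  let N : Matrix V G.edgeSet ℤ := of fun v e => if v ∈ (e : Sym2 V) then 1 else 0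
  have hN1 : Nᵀ * N = (2 : ℤ) • (1 : Matrix G.edgeSet G.edgeSet ℤ) + G.lineGraph.adjMatrix ℤ := by
    ext ⟨e, he⟩ ⟨e', he'⟩
    induction e with | _ u w =>
    induction e' with | _ u' w' =>
    have h1 : u ≠ w := G.ne_of_adj he
    have h2 : u' ≠ w' := G.ne_of_adj he'
    have h3 : ∀ v, (if v = u ∨ v = w then (1 : ℤ) else 0) =
        (if v = u then 1 else 0) + if v = w then 1 else 0 := by
      intro v
      by_cases hu : v = u <;> by_cases hw : v = w <;> simp_all
    simp only [mul_apply, transpose_apply, N, of_apply, Sym2.mem_iff, h3, add_mul, ite_mul,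
      one_mul, zero_mul, Finset.sum_add_distrib, Finset.sum_ite_eq', Finset.mem_univ, if_true,
      Matrix.add_apply, Matrix.smul_apply, one_apply, adjMatrix_apply, lineGraph_adj_iff_exists,
      Subtype.mk.injEq, Sym2.eq_iff, ne_eq]
    have h4 : (∃ v, (v = u ∨ v = w) ∧ (v = u' ∨ v = w')) ↔
        (u = u' ∨ u = w') ∨ (w = u' ∨ w = w') := by aesop
    simp only [h4]
    by_cases a1 : u = u' <;> by_cases a2 : u = w' <;> by_cases a3 : w = u' <;>
      by_cases a4 : w = w' <;> simp_all
  have hN2 : ∀ a b, (N * Nᵀ) a b = (G.degMatrix ℤ + G.adjMatrix ℤ) a b := by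
    intro a b
    have h1 : (N * Nᵀ) a b = (G.incMatrix ℤ * (G.incMatrix ℤ)ᵀ) a b := by
      simp only [mul_apply, transpose_apply]
      rw [← Finset.sum_subset (Finset.subset_univ G.edgeFinset)]
      · rw [← Finset.sum_coe_sort G.edgeFinset
          (fun e => G.incMatrix ℤ a e * G.incMatrix ℤ b e)]
        refine Fintype.sum_equiv (Equiv.subtypeEquivRight fun e : Sym2 V => (mem_edgeFinset (G := G) (e := e)).symm) _ _ ?_
        rintro ⟨e, he⟩
        simp [N, incMatrix_apply', incidenceSet, he]
      · intro e _ he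
        rw [incMatrix_of_notMem_incidenceSet, zero_mul]
        exact fun h => he (mem_edgeFinset.2 h.1)
    rw [h1, incMatrix_mul_transpose]
    by_cases hab : a = b
    · subst hab
      simp [degMatrix]
    · simp [degMatrix, hab, adjMatrix_apply]
  obtain ⟨y, hy0, hy⟩ := exists_mulVec_eq_zero_iff.2 h
  have hy' : Nᵀ *ᵥ (N *ᵥ y) = (2 : ℤ) • y := by
    rw [mulVec_mulVec, hN1, add_mulVec, hy, smul_mulVec, one_mulVec, add_zero]
  refine ⟨N *ᵥ y, fun h0 => hy0 ?_, fun v => ?_⟩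
  · rw [h0, mulVec_zero] at hy'
    exact (smul_eq_zero.1 hy'.symm).resolve_left two_ne_zero
  · have h1 : (G.degMatrix ℤ + G.adjMatrix ℤ) *ᵥ (N *ᵥ y) = (2 : ℤ) • (N *ᵥ y) := by
      rw [← Matrix.ext hN2, ← mulVec_mulVec, hy', mulVec_smul]
    have := congrFun h1 v
    rwa [add_mulVec, Pi.add_apply, degMatrix_mulVec_apply] at this

/-- The terms at `(i, j)` and `(j, i)` cancel mod 2, and the diagonal vanishes. -/
theorem SimpleGraph.two_dvd_dotProduct_adjMatrix_mulVec {V : Type*} [Fintype V]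
    (G : SimpleGraph V) [DecidableRel G.Adj] (x : V → ℤ) :
    2 ∣ x ⬝ᵥ (G.adjMatrix ℤ *ᵥ x) := by
  refine (ZMod.intCast_zmod_eq_zero_iff_dvd _ 2).1 ?_
  simp only [dotProduct, mulVec, Finset.mul_sum, ← Fintype.sum_prod_type', Int.cast_sum]
  refine Finset.sum_involution (fun p _ => p.swap) (fun p _ => ?_) (fun p _ hp h => hp ?_)
    (fun _ _ => Finset.mem_univ _) (fun p _ => p.swap_swap)
  · obtain ⟨i, j⟩ := p
    have : x j * (G.adjMatrix ℤ j i * x i) = x i * (G.adjMatrix ℤ i j * x j) := by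
      simp only [adjMatrix_apply, G.adj_comm j i]
      ring
    simp only [Prod.swap_prod_mk, this]
    exact CharTwo.add_self_eq_zero _
  · obtain ⟨i, j⟩ := p
    obtain rfl : j = i := congrArg Prod.fst h
    simp

/-- If `2` is an eigenvalue of the signless Laplacian, it has a primitive integer eigenvector. -/
theorem SimpleGraph.exists_odd_degree_mul_add_eq_two_mul {V : Type*} [Fintype V]
    {G : SimpleGraph V} [DecidableRel G.Adj] {x : V → ℤ} (hx0 : x ≠ 0)
    (hx : ∀ v, G.degree v * x v + (G.adjMatrix ℤ *ᵥ x) v = 2 * x v) :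
    ∃ y : V → ℤ, (∃ v, Odd (y v)) ∧
      ∀ v, G.degree v * y v + (G.adjMatrix ℤ *ᵥ y) v = 2 * y v := by
  obtain ⟨v₀, hv₀⟩ := Function.ne_iff.1 hx0
  obtain ⟨y, hy, hg⟩ := Finset.univ.extract_gcd x ⟨v₀, Finset.mem_univ _⟩
  set c := Finset.univ.gcd x with hc
  have hc0 : c ≠ 0 := fun h => hv₀ (Finset.gcd_eq_zero_iff.1 h v₀ (Finset.mem_univ _))
  have hxy : x = c • y := funext fun v => hy v (Finset.mem_univ _)
  refine ⟨y, ?_, fun v => mul_left_cancel₀ hc0 ?_⟩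
  · by_contra! h
    have : (2 : ℤ) ∣ Finset.univ.gcd y :=
      Finset.dvd_gcd fun v _ => even_iff_two_dvd.1 (Int.not_odd_iff_even.1 (h v))
    rw [hg] at this
    norm_num at this
  · have := hx v
    simp only [hxy, mulVec_smul, Pi.smul_apply, smul_eq_mul] at this
    linear_combination this

/-! ### Parity of the eigenvector and conclusion -/

theorem SimpleGraph.four_dvd_numSpanningTrees {V : Type*} [Fintype V] [DecidableEq V]
    {G : SimpleGraph V} [DecidableRel G.Adj] (hodd : Odd (Fintype.card V)) {x : V → ℤ}
    (hx1 : ∃ v, Odd (x v))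
    (hx : ∀ v, G.degree v * x v + (G.adjMatrix ℤ *ᵥ x) v = 2 * x v) :
    4 ∣ G.numSpanningTrees := by
  have hA := G.two_dvd_dotProduct_adjMatrix_mulVec x
  have hcol : ∀ v, ∑ u, G.adjMatrix ℤ u v = G.degree v := by
    intro v
    simp [adjMatrix_apply, G.adj_comm _ v, Finset.sum_boole, ← G.neighborFinset_eq_filter]
  have hsumA : ∑ v, (G.adjMatrix ℤ *ᵥ x) v = ∑ v, G.degree v * x v := by
    simp only [mulVec, dotProduct]
    rw [Finset.sum_comm]
    exact Finset.sum_congr rfl fun v _ => by rw [← Finset.sum_mul, hcol]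
  have hsum : ∑ v, x v = ∑ v, G.degree v * x v := by
    have h := Finset.sum_congr rfl fun v (_ : v ∈ Finset.univ) => hx v
    rw [Finset.sum_add_distrib, hsumA, ← Finset.mul_sum] at h
    linarith
  have hquad : ∑ v, G.degree v * (x v * x v) + x ⬝ᵥ (G.adjMatrix ℤ *ᵥ x) =
      2 * ∑ v, x v * x v := by
    rw [dotProduct, ← Finset.sum_add_distrib, Finset.mul_sum]
    exact Finset.sum_congr rfl fun v _ => by linear_combination x v * hx v
  have hsq : ∀ a : ℤ, (2 : ℤ) ∣ a * a - a := fun a => by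
    rw [← mul_sub_one]
    exact even_iff_two_dvd.1 (Int.even_mul_pred_self a)
  have hdeg : (2 : ℤ) ∣ ∑ v, G.degree v * (x v * x v) - ∑ v, G.degree v * x v := by
    rw [← Finset.sum_sub_distrib]
    refine Finset.dvd_sum fun v _ => ?_
    rw [← mul_sub]
    exact (hsq _).mul_left _
  have hxx : (2 : ℤ) ∣ ∑ v, x v * x v - ∑ v, x v := by
    rw [← Finset.sum_sub_distrib]
    exact Finset.dvd_sum fun v _ => hsq _
  -- Mod 2, `∑ x = ∑ deg * x = ∑ deg * x²`, which is even by `hquad` and `hA`.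
  have hsum2 : (2 : ℤ) ∣ ∑ v, x v := by omega
  obtain ⟨r, hr⟩ : ∃ r, Even (x r) := by
    by_contra! h
    have h1 : (2 : ℤ) ∣ ∑ v, (x v - 1) := Finset.dvd_sum fun v _ =>
      even_iff_two_dvd.1 ((Int.not_even_iff_odd.1 (h v)).sub_odd odd_one)
    rw [Finset.sum_sub_distrib] at h1
    simp only [Finset.sum_const, Finset.card_univ, nsmul_eq_mul, mul_one] at h1
    obtain ⟨k, hk⟩ := hodd
    omega
  obtain ⟨i, hi⟩ := hx1
  have hir : i ≠ r := by
    rintro rfl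
    exact Int.not_even_iff_odd.2 hi hr
  -- The Laplacian kills constants, and the shifted vector vanishes at `r`, so deleting that column
  -- loses nothing.
  set z : {v : V // v ≠ r} → ℤ := fun v => x v - x r with hz
  set w : V → ℤ := fun v => x v - (G.adjMatrix ℤ *ᵥ x) v with hw
  have hsub : ∀ F : V → ℤ, F r = 0 → ∑ v : {v : V // v ≠ r}, F v = ∑ v, F v := by
    intro F hF
    rw [← Finset.sum_subtype (Finset.univ.erase r) (by simp) F]
    exact Finset.sum_erase _ hF
  have hLz : G.reducedLapMatrix r *ᵥ z = (2 : ℤ) • fun v : {v : V // v ≠ r} => w v := by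
    funext v
    have h1 : (G.reducedLapMatrix r *ᵥ z) v = ∑ u, G.lapMatrix ℤ v u * (x u - x r) :=
      hsub (fun u => G.lapMatrix ℤ v u * (x u - x r)) (by simp)
    have h2 : ∑ u, G.lapMatrix ℤ v u * x u = (G.lapMatrix ℤ *ᵥ x) v := rfl
    have h3 : ∑ u, G.lapMatrix ℤ v u = 0 := by
      simpa [mulVec, dotProduct] using congrFun (G.lapMatrix_mulVec_const_eq_zero (R := ℤ)) v
    have h4 : (G.lapMatrix ℤ *ᵥ x) v = G.degree v * x v - (G.adjMatrix ℤ *ᵥ x) v := by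
      rw [lapMatrix, sub_mulVec, Pi.sub_apply, degMatrix_mulVec_apply]
    rw [h1]
    simp only [mul_sub, Finset.sum_sub_distrib, ← Finset.sum_mul, h2, h3, h4, Pi.smul_apply,
      smul_eq_mul, hw]
    linear_combination hx v
  have hwz : (2 : ℤ) ∣ (fun v : {v : V // v ≠ r} => w v) ⬝ᵥ z := by
    have h1 : (fun v : {v : V // v ≠ r} => w v) ⬝ᵥ z = ∑ v, w v * (x v - x r) :=
      hsub (fun v => w v * (x v - x r)) (by simp)
    have h2 : ∑ v, w v = 0 := by
      rw [hw, Finset.sum_sub_distrib, hsumA, hsum, sub_self]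
    have h3 : ∑ v, w v * x v = ∑ v, x v * x v - x ⬝ᵥ (G.adjMatrix ℤ *ᵥ x) := by
      rw [dotProduct, ← Finset.sum_sub_distrib]
      exact Finset.sum_congr rfl fun v _ => by simp only [hw]; ring
    rw [h1]
    simp only [mul_sub, Finset.sum_sub_distrib, ← Finset.sum_mul, h2, h3]
    omega
  have hsymm : (G.reducedLapMatrix r).IsSymm := (G.isSymm_lapMatrix (R := ℤ)).submatrix _
  have := hsymm.four_dvd_det hLz hwz (i := ⟨i, hir⟩) (hi.sub_even hr)
  rw [det_reducedLapMatrix] at this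
  exact_mod_cast this

theorem mainTheorem4 {V : Type*} [Fintype V] [DecidableEq V] (G : SimpleGraph V)
    [Fintype G.edgeSet] [DecidableRel G.lineGraph.Adj]
    (hodd : Odd (Fintype.card V)) (hτ : ¬ 4 ∣ G.numSpanningTrees) :
    (G.lineGraph.adjMatrix ℝ).det ≠ 0 := by
  classical
  intro h
  have h1 : G.lineGraph.adjMatrix ℝ = (Int.castRingHom ℝ).mapMatrix (G.lineGraph.adjMatrix ℤ) := by
    ext a b
    simp [SimpleGraph.adjMatrix_apply]
  rw [h1, ← RingHom.map_det, eq_intCast, Int.cast_eq_zero] at h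
  obtain ⟨x, hx0, hx⟩ := G.exists_degree_mul_add_eq_two_mul h
  obtain ⟨y, hy1, hy⟩ := SimpleGraph.exists_odd_degree_mul_add_eq_two_mul hx0 hx
  exact hτ (SimpleGraph.four_dvd_numSpanningTrees hodd hy1 hy)
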